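/- Let $\Omega\subseteq\mathbb{R}^n$ be a smooth domain (nonempty, open, connected, bounded or unbounded, with smooth, possibly empty, boundary), let $T\in(0,\infty]$ and $\Omega_T=\Omega\times(0,T)$. Let $K(t,x,y)\ge 0$ be the Dirichlet heat kernel of $\Omega$, that is, the least nonnegative function, continuous for $t>0$, $x\in\overline\Omega$, $y\in\Omega$, such that for every $y\in\Omega$ the function $(t,x)\mapsto K(t,x,y)$ satisfies $\partial_tK=\Delta_xK$ in $(0,\infty)\times\Omega$, vanishes for $x\in\partial\Omega$, and has initial value $\delta_y$, in the sense that $\int_\Omega K(t,x,y)\eta(x)\,dx\to\eta(y)$ as $t\downarrow0$ for all $\eta\in C_c(\Omega)$ (for bounded $\Omega$ such a function is unique). For measurable $\psi\ge0$ on $\Omega$ and $t>0$ put $$(S(t)\psi)(x)=\int_\Omega K(t,x,y)\,\psi(y)\,dy\in[0,\infty].$$ Let $f:[0,\infty)\to[0,\infty)$ be continuous and nondecreasing, let $\phi\in L^1(\Omega)$ with $\phi\ge0$ a.e., and let $$\mathcal F[v](t)=S(t)\phi+\int_0^tS(t-s)f(v(s))\,ds ,\qquad 0<t<T,$$ for $v\in\mathcal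 M_T^+$, the set of nonnegative, almost everywhere finite, measurable functions on $\Omega_T$. A solution in $\Omega_T$ is a $u\in\mathcal M_T^+$ with $\mathcal F[u]=u$ a.e. in $\Omega_T$; a supersolution in $\Omega_T$ is a $w\in\mathcal M_T^+$ with $\mathcal F[w]\le w$ a.e. in $\Omega_T$. Then $\mathcal F$ admits a solution in $\Omega_T$ if and only if it admits a supersolution in $\Omega_T$. -/

import Mathlib

open MeasureTheory Set Filter Topology
open scoped ENNReal NNReal ContDiff

namespace HeatSuper

/-- A smooth domain of `ℝⁿ`: a nonempty connected open set which near every boundary point is the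
negativity set of a smooth function with nonvanishing differential (so that it lies locally on one
side of its smooth boundary). The boundary may be empty and the domain may be unbounded. -/
structure IsSmoothDomain {n : ℕ} (Ω : Set (EuclideanSpace ℝ (Fin n))) : Prop where
  isOpen : IsOpen Ω
  isConnected : IsConnected Ω
  smooth_boundary : ∀ p ∈ frontier Ω, ∃ U : Set (EuclideanSpace ℝ (Fin n)),
    IsOpen U ∧ p ∈ U ∧ ∃ ρ : EuclideanSpace ℝ (Fin n) → ℝ,
      ContDiffOn ℝ ∞ ρ U ∧ fderiv ℝ ρ p ≠ 0 ∧ Ω ∩ U = {x ∈ U | ρ x < 0}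

/-- `G t x y` is a nonnegative fundamental solution of the Dirichlet problem for the heat equation
in `Ω`: it is continuous for `t > 0`, `x ∈ closure Ω`, `y ∈ Ω`, and for every pole `y ∈ Ω` the
function `(t, x) ↦ G t x y` solves `∂ₜ G = Δ G` in `Ω`, vanishes on the boundary of `Ω`,
and has the Dirac mass at `y` as its initial value. -/
structure IsDirichletFundamentalSolution {n : ℕ} (Ω : Set (EuclideanSpace ℝ (Fin n)))
    (G : ℝ → EuclideanSpace ℝ (Fin n) → EuclideanSpace ℝ (Fin n) → ℝ) : Prop where
  nonneg : ∀ t > 0, ∀ x ∈ closure Ω, ∀ y ∈ Ω, 0 ≤ G t x y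
  continuousOn : ContinuousOn
    (fun q : ℝ × EuclideanSpace ℝ (Fin n) × EuclideanSpace ℝ (Fin n) => G q.1 q.2.1 q.2.2)
    (Ioi 0 ×ˢ closure Ω ×ˢ Ω)
  contDiffOn : ∀ t > 0, ∀ y ∈ Ω, ContDiffOn ℝ 2 (fun x => G t x y) Ω
  heat_eq : ∀ t > 0, ∀ x ∈ Ω, ∀ y ∈ Ω,
    HasDerivAt (fun s => G s x y) (Laplacian.laplacian (fun z => G t z y) x) t
  boundary : ∀ t > 0, ∀ x ∈ frontier Ω, ∀ y ∈ Ω, G t x y = 0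
  initial : ∀ y ∈ Ω, ∀ η : EuclideanSpace ℝ (Fin n) → ℝ,
    Continuous η → HasCompactSupport η → tsupport η ⊆ Ω →
      Tendsto (fun t => ∫ x in Ω, G t x y * η x) (𝓝[>] 0) (𝓝 (η y))

/-- The Dirichlet heat kernel of `Ω`: the least nonnegative fundamental solution of the Dirichlet
problem. If `Ω` is bounded and smooth there is only one such fundamental solution; in an unbounded
domain there may be several, and the heat kernel is the least of them. -/
noncomputable def heatKernel {n : ℕ} (Ω : Set (EuclideanSpace ℝ (Fin n)))
    (t : ℝ) (x y : EuclideanSpace ℝ (Fin n)) : ℝ :=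
  ⨅ G : {G : ℝ → EuclideanSpace ℝ (Fin n) → EuclideanSpace ℝ (Fin n) → ℝ //
    IsDirichletFundamentalSolution Ω G}, G.1 t x y

/-- The Dirichlet heat semigroup `(S(t)ψ)(x) = ∫_Ω K(t,x,y) ψ(y) dy`, for `t > 0`, acting on
functions with values in `[0,∞]`. -/
noncomputable def heatSemigroup {n : ℕ} (Ω : Set (EuclideanSpace ℝ (Fin n)))
    (t : ℝ) (ψ : EuclideanSpace ℝ (Fin n) → ℝ≥0∞) (x : EuclideanSpace ℝ (Fin n)) : ℝ≥0∞ :=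
  ∫⁻ y in Ω, ENNReal.ofReal (heatKernel Ω t x y) * ψ y

/-- The cylinder `Ω_T = Ω × (0,T)`, where `T = ∞` is allowed. -/
def cylinder {n : ℕ} (Ω : Set (EuclideanSpace ℝ (Fin n))) (T : EReal) :
    Set (EuclideanSpace ℝ (Fin n) × ℝ) :=
  {q | q.1 ∈ Ω ∧ 0 < q.2 ∧ (q.2 : EReal) < T}

/-- Nonnegative, almost everywhere finite, (Lebesgue) measurable functions on `Ω_T`. -/
def MemMPlus {n : ℕ} (Ω : Set (EuclideanSpace ℝ (Fin n))) (T : EReal)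
    (v : EuclideanSpace ℝ (Fin n) × ℝ → ℝ≥0∞) : Prop :=
  AEMeasurable v (volume.restrict (cylinder Ω T)) ∧
    ∀ᵐ q ∂(volume.restrict (cylinder Ω T)), v q < ⊤

/-- `F[v](t) = S(t)φ + ∫₀ᵗ S(t-s) f(v(s)) ds`, evaluated at `q = (x,t)`. For `v` finite almost
everywhere, `f (v (y, s)).toNNReal` is `f(v(s,y))` for almost every `(y,s)`. -/
noncomputable def opF {n : ℕ} (Ω : Set (EuclideanSpace ℝ (Fin n))) (f : ℝ≥0 → ℝ≥0)
    (φ : EuclideanSpace ℝ (Fin n) → ℝ) (v : EuclideanSpace ℝ (Fin n) × ℝ → ℝ≥0∞)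
    (q : EuclideanSpace ℝ (Fin n) × ℝ) : ℝ≥0∞ :=
  heatSemigroup Ω q.2 (fun y => ENNReal.ofReal (φ y)) q.1 +
    ∫⁻ s in Ioo 0 q.2,
      heatSemigroup Ω (q.2 - s) (fun y => (f (v (y, s)).toNNReal : ℝ≥0∞)) q.1

/-- A solution in `Ω_T`: `F[u] = u` almost everywhere in `Ω_T`. -/
def IsSolution {n : ℕ} (Ω : Set (EuclideanSpace ℝ (Fin n))) (T : EReal) (f : ℝ≥0 → ℝ≥0)
    (φ : EuclideanSpace ℝ (Fin n) → ℝ) (u : EuclideanSpace ℝ (Fin n) × ℝ → ℝ≥0∞) : Prop :=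
  MemMPlus Ω T u ∧ ∀ᵐ q ∂(volume.restrict (cylinder Ω T)), opF Ω f φ u q = u q

/-- A supersolution in `Ω_T`: `F[w] ≤ w` almost everywhere in `Ω_T`. -/
def IsSupersolution {n : ℕ} (Ω : Set (EuclideanSpace ℝ (Fin n))) (T : EReal) (f : ℝ≥0 → ℝ≥0)
    (φ : EuclideanSpace ℝ (Fin n) → ℝ) (w : EuclideanSpace ℝ (Fin n) × ℝ → ℝ≥0∞) : Prop :=
  MemMPlus Ω T w ∧ ∀ᵐ q ∂(volume.restrict (cylinder Ω T)), opF Ω f φ w q ≤ w q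

end HeatSuper

namespace HeatSuper

/-! Monotone iteration from zero. The kernel is nonnegative and $f$ is nondecreasing, so the
iterates $\mathcal F^k[0]$ increase; by induction they stay a.e. below any supersolution $w$, since
$\mathcal F^{k+1}[0]\le\mathcal F[w]\le w$. As $f$ is continuous, monotone convergence makes their
supremum a fixed point (`duhamel_iSup`, `duhamel_iSup_iter`), and $w$ makes it finite a.e. Of the
kernel only nonnegativity and joint measurability matter.

The iterates may be infinite before $w$ is brought in, so the iteration runs with `duhamel`, a
version of $\mathcal F$ on $[0,\infty]$-valued functions; `duhamel_eq_opF` returns to $\mathcal F$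
once finiteness is known. -/

/-! ### The extended nonlinearity -/

/-- The left-continuous extension to `[0,∞]` of a function on `[0,∞)`, when `f` is continuous and
nondecreasing. -/
noncomputable def extNonlin (f : ℝ≥0 → ℝ≥0) (a : ℝ≥0∞) : ℝ≥0∞ :=
  ⨆ m : ℕ, (f (min a m).toNNReal : ℝ≥0∞)

/-- Truncating at `m` avoids `⊤`, where `toNNReal` drops to `0` and would spoil both continuity and
monotonicity. -/
theorem continuous_truncNonlin {f : ℝ≥0 → ℝ≥0} (hf : Continuous f) (m : ℕ) :
    Continuous fun a : ℝ≥0∞ => (f (min a m).toNNReal : ℝ≥0∞) := by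
  refine ENNReal.continuous_coe.comp (hf.comp ?_)
  refine ENNReal.continuousOn_toNNReal.comp_continuous (by fun_prop) fun a => ?_
  exact ((min_le_right a (m : ℝ≥0∞)).trans_lt (ENNReal.natCast_lt_top m)).ne

theorem monotone_truncNonlin {f : ℝ≥0 → ℝ≥0} (hf : Monotone f) (m : ℕ) :
    Monotone fun a : ℝ≥0∞ => (f (min a m).toNNReal : ℝ≥0∞) := by
  intro a b hab
  refine ENNReal.coe_le_coe.2 (hf (ENNReal.toNNReal_mono ?_ (min_le_min_right _ hab)))
  exact ((min_le_right b (m : ℝ≥0∞)).trans_lt (ENNReal.natCast_lt_top m)).ne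

theorem measurable_extNonlin {f : ℝ≥0 → ℝ≥0} (hf : Continuous f) : Measurable (extNonlin f) :=
  Measurable.iSup fun m => (continuous_truncNonlin hf m).measurable

theorem monotone_extNonlin {f : ℝ≥0 → ℝ≥0} (hf : Monotone f) : Monotone (extNonlin f) :=
  fun _ _ hab => iSup_mono fun m => monotone_truncNonlin hf m hab

theorem extNonlin_iSup {f : ℝ≥0 → ℝ≥0} (hc : Continuous f) (hm : Monotone f) (a : ℕ → ℝ≥0∞) :
    extNonlin f (⨆ k, a k) = ⨆ k, extNonlin f (a k) := by
  unfold extNonlin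
  -- After the swap, each truncation, being continuous and monotone, commutes with the supremum.
  rw [iSup_comm]
  exact iSup_congr fun m => Monotone.map_ciSup_of_continuousAt
    (continuous_truncNonlin hc m).continuousAt (monotone_truncNonlin hm m)

theorem extNonlin_of_lt_top {f : ℝ≥0 → ℝ≥0} (hm : Monotone f) {a : ℝ≥0∞} (ha : a < ⊤) :
    extNonlin f a = f a.toNNReal := by
  refine le_antisymm (iSup_le fun m => ENNReal.coe_le_coe.2
    (hm (ENNReal.toNNReal_mono ha.ne (min_le_left _ _)))) ?_
  obtain ⟨m, hmn⟩ := ENNReal.exists_nat_gt ha.ne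
  refine le_iSup_of_le m ?_
  rw [min_eq_left hmn.le]

/-! ### Measurability of the heat kernel -/

variable {n : ℕ} {Ω : Set (EuclideanSpace ℝ (Fin n))}

/-- The heat kernel, extended by zero outside `t > 0`, `x ∈ closure Ω`, `y ∈ Ω`. -/
noncomputable def extKernel (Ω : Set (EuclideanSpace ℝ (Fin n))) :
    ℝ × EuclideanSpace ℝ (Fin n) × EuclideanSpace ℝ (Fin n) → ℝ≥0∞ :=
  (Ioi 0 ×ˢ closure Ω ×ˢ Ω).indicator fun q => ENNReal.ofReal (heatKernel Ω q.1 q.2.1 q.2.2)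

theorem extKernel_eq {t : ℝ} (ht : 0 < t) {x y : EuclideanSpace ℝ (Fin n)} (hx : x ∈ Ω)
    (hy : y ∈ Ω) : extKernel Ω (t, x, y) = ENNReal.ofReal (heatKernel Ω t x y) :=
  indicator_of_mem (by exact ⟨ht, subset_closure hx, hy⟩) _

theorem extKernel_of_nonpos {t : ℝ} (ht : t ≤ 0) (x y : EuclideanSpace ℝ (Fin n)) :
    extKernel Ω (t, x, y) = 0 :=
  indicator_of_notMem (fun h => absurd h.1 (not_lt.2 ht)) _

/-- The heat kernel is an infimum of nonnegative continuous functions, hence upper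
semicontinuous. -/
theorem upperSemicontinuous_heatKernel_domRestrict :
    UpperSemicontinuous ((Ioi (0 : ℝ) ×ˢ closure Ω ×ˢ Ω).domRestrict
      fun q => heatKernel Ω q.1 q.2.1 q.2.2) := by
  unfold heatKernel
  refine upperSemicontinuous_ciInf (fun q => ?_) fun G => ?_
  · refine ⟨0, ?_⟩
    rintro _ ⟨G, rfl⟩
    exact G.2.nonneg _ q.2.1 _ q.2.2.1 _ q.2.2.2
  · exact (continuousOn_iff_continuous_domRestrict.1 G.2.continuousOn).upperSemicontinuous

/-- Upper semicontinuity gives Borel measurability on the domain; outside it the kernel is zero. -/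
theorem measurable_extKernel (hΩ : IsOpen Ω) : Measurable (extKernel Ω) := by
  have hD : MeasurableSet (Ioi (0 : ℝ) ×ˢ closure Ω ×ˢ Ω) :=
    measurableSet_Ioi.prod (isClosed_closure.measurableSet.prod hΩ.measurableSet)
  refine measurable_of_restrict_of_restrict_compl hD ?_ ?_
  · have h := (upperSemicontinuous_heatKernel_domRestrict (Ω := Ω)).measurable.ennreal_ofReal
    convert h using 1
    funext q
    simp only [domRestrict_apply, extKernel, indicator_of_mem q.2]
  · convert measurable_const (a := (0 : ℝ≥0∞)) using 1
    funext q
    simp only [domRestrict_apply, extKernel, indicator_of_notMem q.2]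

/-! ### The iteration operator -/

/-- The Duhamel operator with the extended kernel and the extended nonlinearity. -/
noncomputable def duhamel (Ω : Set (EuclideanSpace ℝ (Fin n))) (f : ℝ≥0 → ℝ≥0)
    (g : EuclideanSpace ℝ (Fin n) → ℝ≥0∞) (v : EuclideanSpace ℝ (Fin n) × ℝ → ℝ≥0∞)
    (q : EuclideanSpace ℝ (Fin n) × ℝ) : ℝ≥0∞ :=
  (∫⁻ y in Ω, extKernel Ω (q.2, q.1, y) * g y) +
    ∫⁻ s in Ioi 0, ∫⁻ y in Ω, extKernel Ω (q.2 - s, q.1, y) * extNonlin f (v (y, s))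

theorem measurable_duhamel (hΩ : IsOpen Ω) {f : ℝ≥0 → ℝ≥0} (hf : Continuous f)
    {g : EuclideanSpace ℝ (Fin n) → ℝ≥0∞} (hg : Measurable g)
    {v : EuclideanSpace ℝ (Fin n) × ℝ → ℝ≥0∞} (hv : Measurable v) :
    Measurable (duhamel Ω f g v) := by
  have hK := measurable_extKernel hΩ
  have hE := measurable_extNonlin hf
  refine Measurable.add ?_ ?_
  · refine Measurable.lintegral_prod_right' (f := fun p : (EuclideanSpace ℝ (Fin n) × ℝ) ×
      EuclideanSpace ℝ (Fin n) => extKernel Ω (p.1.2, p.1.1, p.2) * g p.2) ?_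
    fun_prop
  · refine Measurable.lintegral_prod_right' (f := fun p : (EuclideanSpace ℝ (Fin n) × ℝ) × ℝ =>
      ∫⁻ y in Ω, extKernel Ω (p.1.2 - p.2, p.1.1, y) * extNonlin f (v (y, p.2))) ?_
    refine Measurable.lintegral_prod_right' (f := fun p : ((EuclideanSpace ℝ (Fin n) × ℝ) × ℝ) ×
      EuclideanSpace ℝ (Fin n) =>
        extKernel Ω (p.1.1.2 - p.1.2, p.1.1.1, p.2) * extNonlin f (v (p.2, p.1.2))) ?_
    fun_prop

theorem monotone_duhamel {f : ℝ≥0 → ℝ≥0} (hf : Monotone f)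
    (g : EuclideanSpace ℝ (Fin n) → ℝ≥0∞) : Monotone (duhamel Ω f g) := by
  intro v w hvw q
  refine add_le_add le_rfl (lintegral_mono fun s => lintegral_mono fun y => ?_)
  exact mul_le_mul_right (monotone_extNonlin hf (hvw (y, s))) _

/-- The Duhamel operator commutes with suprema of nondecreasing sequences. -/
theorem duhamel_iSup (hΩ : IsOpen Ω) {f : ℝ≥0 → ℝ≥0} (hc : Continuous f) (hm : Monotone f)
    (g : EuclideanSpace ℝ (Fin n) → ℝ≥0∞) {v : ℕ → EuclideanSpace ℝ (Fin n) × ℝ → ℝ≥0∞}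
    (hv : ∀ k, Measurable (v k)) (hvm : Monotone v) (q : EuclideanSpace ℝ (Fin n) × ℝ) :
    duhamel Ω f g (⨆ k, v k) q = ⨆ k, duhamel Ω f g (v k) q := by
  have hK := measurable_extKernel hΩ
  have hE := measurable_extNonlin hc
  unfold duhamel
  rw [← ENNReal.add_iSup, ← lintegral_iSup]
  · congr 1
    refine lintegral_congr fun s => ?_
    rw [← lintegral_iSup]
    · refine lintegral_congr fun y => ?_
      rw [iSup_apply, extNonlin_iSup hc hm, ENNReal.mul_iSup]
    · intro k
      have := hv k
      fun_prop
    · intro i j hij y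
      exact mul_le_mul_right (monotone_extNonlin hm (hvm hij (y, s))) _
  · intro k
    have := hv k
    refine Measurable.lintegral_prod_right' (f := fun p : ℝ × EuclideanSpace ℝ (Fin n) =>
        extKernel Ω (q.2 - p.1, q.1, p.2) * extNonlin f (v k (p.2, p.1))) ?_
    fun_prop
  · intro i j hij s
    refine lintegral_mono fun y => ?_
    exact mul_le_mul_right (monotone_extNonlin hm (hvm hij (y, s))) _

/-- A property valid almost everywhere in `Ω_T` is valid, for almost every time `s < t < T`, almost
everywhere in `Ω`. -/
theorem ae_ae_of_ae_cylinder {T : EReal}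
    {p : EuclideanSpace ℝ (Fin n) × ℝ → Prop} (h : ∀ᵐ q ∂(volume.restrict (cylinder Ω T)), p q)
    {t : ℝ} (ht : (t : EReal) < T) :
    ∀ᵐ s ∂(volume.restrict (Ioo 0 t)), ∀ᵐ y ∂(volume.restrict Ω), p (y, s) := by
  have hsub : Ω ×ˢ Ioo 0 t ⊆ cylinder Ω T := fun q hq =>
    ⟨hq.1, hq.2.1, (EReal.coe_lt_coe_iff.2 hq.2.2).trans ht⟩
  have h' := ae_mono (Measure.restrict_mono hsub le_rfl) h
  rw [Measure.volume_eq_prod, ← Measure.prod_restrict, ← Measure.prod_swap] at h'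
  exact Measure.ae_ae_of_ae_prod (ae_of_ae_map measurable_swap.aemeasurable h')

/-- The extended kernel vanishes for `s ≥ t`. Hence `duhamel` can integrate over a time set
independent of `t`, which makes its measurability a direct Tonelli argument. -/
theorem setLIntegral_Ioi_extKernel (x : EuclideanSpace ℝ (Fin n)) (t : ℝ)
    (F : ℝ → EuclideanSpace ℝ (Fin n) → ℝ≥0∞) :
    ∫⁻ s in Ioi 0, ∫⁻ y in Ω, extKernel Ω (t - s, x, y) * F s y =
      ∫⁻ s in Ioo 0 t, ∫⁻ y in Ω, extKernel Ω (t - s, x, y) * F s y := by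
  rw [← Ioi_inter_Iio, inter_comm, ← setLIntegral_indicator measurableSet_Iio]
  refine lintegral_congr fun s => ?_
  by_cases hs : s < t
  · rw [indicator_of_mem (by exact hs)]
  · rw [indicator_of_notMem (by exact hs)]
    simp [extKernel_of_nonpos (sub_nonpos.2 (not_lt.1 hs))]

theorem measurableSet_cylinder (hΩ : IsOpen Ω) (T : EReal) : MeasurableSet (cylinder Ω T) := by
  refine (hΩ.measurableSet.preimage measurable_fst).inter
    ((measurableSet_Ioi.preimage measurable_snd).inter ?_)
  exact measurableSet_Iio.preimage (measurable_coe_real_ereal.comp measurable_snd)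

/-- On finite functions the Duhamel operator is `F`. -/
theorem duhamel_eq_opF (hΩ : IsOpen Ω) {T : EReal} {f : ℝ≥0 → ℝ≥0} (hm : Monotone f)
    {φ : EuclideanSpace ℝ (Fin n) → ℝ} {g : EuclideanSpace ℝ (Fin n) → ℝ≥0∞}
    (hg : (fun y => ENNReal.ofReal (φ y)) =ᵐ[volume.restrict Ω] g)
    {v : EuclideanSpace ℝ (Fin n) × ℝ → ℝ≥0∞}
    (hv : ∀ᵐ q ∂(volume.restrict (cylinder Ω T)), v q < ⊤)
    {q : EuclideanSpace ℝ (Fin n) × ℝ} (hq : q ∈ cylinder Ω T) :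
    duhamel Ω f g v q = opF Ω f φ v q := by
  obtain ⟨hx, ht, htT⟩ := hq
  unfold duhamel opF heatSemigroup
  rw [setLIntegral_Ioi_extKernel q.1 q.2 fun s y => extNonlin f (v (y, s))]
  congr 1
  · refine lintegral_congr_ae ?_
    filter_upwards [hg, ae_restrict_mem hΩ.measurableSet] with y hy hyΩ
    rw [extKernel_eq ht hx hyΩ, ← hy]
  · refine lintegral_congr_ae ?_
    filter_upwards [ae_ae_of_ae_cylinder hv htT, ae_restrict_mem measurableSet_Ioo] with s hs hst
    refine lintegral_congr_ae ?_
    filter_upwards [hs, ae_restrict_mem hΩ.measurableSet] with y hy hyΩ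
    rw [extKernel_eq (sub_pos.2 hst.2) hx hyΩ, extNonlin_of_lt_top hm hy]

/-- The Duhamel operator is monotone with respect to the almost everywhere order in `Ω_T`. -/
theorem duhamel_mono_ae {T : EReal} {f : ℝ≥0 → ℝ≥0} (hm : Monotone f)
    (g : EuclideanSpace ℝ (Fin n) → ℝ≥0∞) {v w : EuclideanSpace ℝ (Fin n) × ℝ → ℝ≥0∞}
    (hvw : ∀ᵐ q ∂(volume.restrict (cylinder Ω T)), v q ≤ w q)
    {q : EuclideanSpace ℝ (Fin n) × ℝ} (hq : q ∈ cylinder Ω T) :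
    duhamel Ω f g v q ≤ duhamel Ω f g w q := by
  unfold duhamel
  rw [setLIntegral_Ioi_extKernel q.1 q.2 fun s y => extNonlin f (v (y, s)),
    setLIntegral_Ioi_extKernel q.1 q.2 fun s y => extNonlin f (w (y, s))]
  refine add_le_add le_rfl (lintegral_mono_ae ?_)
  filter_upwards [ae_ae_of_ae_cylinder hvw hq.2.2] with s hs
  refine lintegral_mono_ae ?_
  filter_upwards [hs] with y hy
  exact mul_le_mul_right (monotone_extNonlin hm hy) _

/-! ### Monotone iteration -/

/-- The iterates of the Duhamel operator starting from zero. -/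
noncomputable def iter (Ω : Set (EuclideanSpace ℝ (Fin n))) (f : ℝ≥0 → ℝ≥0)
    (g : EuclideanSpace ℝ (Fin n) → ℝ≥0∞) (k : ℕ) : EuclideanSpace ℝ (Fin n) × ℝ → ℝ≥0∞ :=
  (duhamel Ω f g)^[k] ⊥

theorem iter_succ (f : ℝ≥0 → ℝ≥0) (g : EuclideanSpace ℝ (Fin n) → ℝ≥0∞) (k : ℕ) :
    iter Ω f g (k + 1) = duhamel Ω f g (iter Ω f g k) :=
  Function.iterate_succ_apply' _ _ _

theorem measurable_iter (hΩ : IsOpen Ω) {f : ℝ≥0 → ℝ≥0} (hf : Continuous f)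
    {g : EuclideanSpace ℝ (Fin n) → ℝ≥0∞} (hg : Measurable g) (k : ℕ) :
    Measurable (iter Ω f g k) := by
  induction k with
  | zero => exact measurable_const
  | succ k ih => rw [iter_succ]; exact measurable_duhamel hΩ hf hg ih

theorem monotone_iter {f : ℝ≥0 → ℝ≥0} (hf : Monotone f)
    (g : EuclideanSpace ℝ (Fin n) → ℝ≥0∞) : Monotone (iter Ω f g) :=
  (monotone_duhamel hf g).monotone_iterate_of_le_map bot_le

/-- The limit of the iterates is a fixed point of the Duhamel operator. -/
theorem duhamel_iSup_iter (hΩ : IsOpen Ω) {f : ℝ≥0 → ℝ≥0} (hc : Continuous f) (hm : Monotone f)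
    {g : EuclideanSpace ℝ (Fin n) → ℝ≥0∞} (hg : Measurable g) :
    duhamel Ω f g (⨆ k, iter Ω f g k) = ⨆ k, iter Ω f g k := by
  funext q
  rw [duhamel_iSup hΩ hc hm g (measurable_iter hΩ hc hg) (monotone_iter hm g), iSup_apply,
    -- Dropping the zeroth term does not change the supremum of an increasing sequence.
    ← (show Monotone fun k => iter Ω f g k q from
      fun i j hij => monotone_iter hm g hij q).iSup_nat_add 1]
  exact iSup_congr fun k => by rw [iter_succ]

/-- Below every supersolution there is a solution. -/
theorem IsSupersolution.exists_isSolution_le (hΩ : IsOpen Ω) {T : EReal} {f : ℝ≥0 → ℝ≥0}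
    (hc : Continuous f) (hm : Monotone f) {φ : EuclideanSpace ℝ (Fin n) → ℝ}
    (hφ : AEMeasurable φ (volume.restrict Ω)) {w : EuclideanSpace ℝ (Fin n) × ℝ → ℝ≥0∞}
    (hw : IsSupersolution Ω T f φ w) :
    ∃ u, IsSolution Ω T f φ u ∧ ∀ᵐ q ∂(volume.restrict (cylinder Ω T)), u q ≤ w q := by
  obtain ⟨⟨-, hwfin⟩, hsup⟩ := hw
  have hφ' := hφ.ennreal_ofReal
  -- A Borel representative of the initial datum makes every iterate measurable everywhere.
  set g := hφ'.mk _
  have hg : Measurable g := hφ'.measurable_mk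
  have hgφ : (fun y => ENNReal.ofReal (φ y)) =ᵐ[volume.restrict Ω] g := hφ'.ae_eq_mk
  have hcyl := ae_restrict_mem (μ := volume) (measurableSet_cylinder hΩ T)
  have hle : ∀ k, ∀ᵐ q ∂(volume.restrict (cylinder Ω T)), iter Ω f g k q ≤ w q := by
    intro k
    induction k with
    | zero => exact ae_of_all _ fun q => bot_le
    | succ k ih =>
      filter_upwards [hsup, hcyl] with q hq hqT
      rw [iter_succ]
      refine (duhamel_mono_ae hm g ih hqT).trans ?_
      rwa [duhamel_eq_opF hΩ hm hgφ hwfin hqT]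
  have hule : ∀ᵐ q ∂(volume.restrict (cylinder Ω T)), (⨆ k, iter Ω f g k) q ≤ w q := by
    filter_upwards [ae_all_iff.2 hle] with q hq
    rw [iSup_apply]
    exact iSup_le hq
  have hufin : ∀ᵐ q ∂(volume.restrict (cylinder Ω T)), (⨆ k, iter Ω f g k) q < ⊤ := by
    filter_upwards [hule, hwfin] with q h1 h2 using h1.trans_lt h2
  have hum : Measurable (⨆ k, iter Ω f g k) := by
    rw [show (⨆ k, iter Ω f g k) = fun q => ⨆ k, iter Ω f g k q from funext fun q => iSup_apply]
    exact Measurable.iSup fun k => measurable_iter hΩ hc hg k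
  refine ⟨⨆ k, iter Ω f g k, ⟨⟨hum.aemeasurable, hufin⟩, ?_⟩, hule⟩
  -- The fixed-point identity holds everywhere; finiteness a.e. is needed only to replace `duhamel`
  -- by `opF`.
  filter_upwards [hcyl] with q hqT
  rw [← duhamel_eq_opF hΩ hm hgφ hufin hqT, duhamel_iSup_iter hΩ hc hm hg]

theorem IsSolution.isSupersolution {T : EReal} {f : ℝ≥0 → ℝ≥0}
    {φ : EuclideanSpace ℝ (Fin n) → ℝ} {u : EuclideanSpace ℝ (Fin n) × ℝ → ℝ≥0∞}
    (hu : IsSolution Ω T f φ u) : IsSupersolution Ω T f φ u :=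
  ⟨hu.1, hu.2.mono fun _ h => h.le⟩

end HeatSuper

theorem mainTheorem1 {n : ℕ} (Ω : Set (EuclideanSpace ℝ (Fin n)))
    (hΩ : HeatSuper.IsSmoothDomain Ω) (T : EReal) (hT : 0 < T)
    (f : ℝ≥0 → ℝ≥0) (hf_cont : Continuous f) (hf_mono : Monotone f)
    (φ : EuclideanSpace ℝ (Fin n) → ℝ) (hφ_int : IntegrableOn φ Ω volume)
    (hφ_nonneg : ∀ᵐ x ∂(volume.restrict Ω), 0 ≤ φ x) :
    (∃ u, HeatSuper.IsSolution Ω T f φ u) ↔ (∃ w, HeatSuper.IsSupersolution Ω T f φ w) := by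
  refine ⟨fun ⟨u, hu⟩ => ⟨u, hu.isSupersolution⟩, fun ⟨w, hw⟩ => ?_⟩
  obtain ⟨u, hu, -⟩ := hw.exists_isSolution_le hΩ.isOpen hf_cont hf_mono
    hφ_int.aestronglyMeasurable.aemeasurable
  exact ⟨u, hu⟩
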